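/- Let $n\ge 0$, and for $i\in[n]$ let $d_i$ be a nonnegative integer and $p_{i0}<p_{i1}<\dots<p_{id_i}$ real numbers. Put $\mathcal X=\prod_{i\in[n]}\{p_{i0},\dots,p_{id_i}\}$ and $P=\{x\in\mathbb R^n : Ax\ge c\}$ with $A\in\mathbb R^{m\times n}$, $c\in\mathbb R^m$. Let $a_0,\dots,a_n\in\mathbb R$, $b_0,\dots,b_n\ge 0$, and let $f_i,g_i$ be real functions of one variable, where each $f_i$ is nondecreasing on $\{p_{i0},\dots,p_{id_i}\}$ and $b_0+\sum_{i}b_if_i(x_i)>0$ for every $x\in\mathcal X$. Consider the problem $$\max\Bigl\{F(x):=\frac{a_0+\sum_{i}a_if_i(x_i)}{b_0+\sum_{i}b_if_i(x_i)}+\sum_{i}g_i(x_i)\ \Bigm|\ x\in P\cap\mathcal X\Bigr\}.\qquad(\mathrm{Ratio})$$ Write $f_{ij}=f_i(p_{ij})$, $g_{ij}=g_i(p_{ij})$. Consider the following program in the variables $x,y,\mu\in\mathbb R^n$, $\rho,\nu\in\mathbb R$, $z_{ij},s_{ij}$ ($i\in[n]$, $j\in[d_i]$) and $Z^k_{ij}$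 ($k,i\in[n]$, $j\in[d_k]$): maximize $a_0\rho+\sum_i a_i\mu_i+\nu$ subject to $$\begin{aligned} & Ax\ge c,\quad x_i=p_{i0}+\sum_{j\in[d_i]}(p_{ij}-p_{i,j-1})z_{ij},\quad 1\ge z_{i1}\ge\dots\ge z_{id_i}\ge 0,\quad z_{ij}\in\{0,1\},\\ & b_0\rho+\sum_i b_i\mu_i=1,\quad \mu_i=f_{i0}\,\rho+\sum_{j\in[d_i]}(f_{ij}-f_{i,j-1})s_{ij},\quad \rho\ge s_{i1}\ge\dots\ge s_{id_i}\ge 0,\\ & Ay\ge c\,\rho,\quad y_i=p_{i0}\,\rho+\sum_{j\in[d_i]}(p_{ij}-p_{i,j-1})s_{ij},\\ & \nu\le\sum_{i}\Bigl(g_{i0}+\sum_{j\in[d_i]}(g_{ij}-g_{i,j-1})z_{ij}\Bigr),\\ & z_{kj}=b_0s_{kj}+\sum_i b_iZ^k_{ij}\quad(k\in[n],\ j\in[d_k]),\\ & Z^k_{ij}\le\min_{0\le\tau\le d_i}\Bigl\{f_{i\tau}s_{kj}+\sum_{t>\tau}(f_{it}-f_{i,t-1})s_{it}\Bigr\}\quad(k\in[n],\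 i\ne k,\ j\in[d_k]),\\ & Z^k_{ij}\ge\max_{0\le\tau\le d_i}\Bigl\{f_{i0}\,\rho+\sum_{1\le t\le\tau}(f_{it}-f_{i,t-1})s_{it}+f_{i\tau}s_{kj}-f_{i\tau}\rho\Bigr\}\quad(k\in[n],\ i\ne k,\ j\in[d_k]),\\ & Z^k_{kj}=f_{kj}s_{kj}+\sum_{t>j}(f_{kt}-f_{k,t-1})s_{kt}\quad(k\in[n],\ j\in[d_k]). \end{aligned}$$ Then this program is a mixed-integer linear programming formulation of (Ratio): the set of pairs ($x$, objective value) of its feasible points is $\{(x,t): x\in P\cap\mathcal X,\ t\le F(x)\}$; in particular both problems have the same optimal value, and the optimal solutions of (Ratio) are exactly the $x$-parts of the optimal solutions of the program. Moreover, if $P=\mathbb R^n$ and every $g_i$ is nondecreasing on $\{p_{i0},\dots,p_{id_i}\}$, then the LP relaxation, obtained by dropping $z_{ij}\in\{0,1\}$, solves (Ratio): both maxima are attained and are equal, and the optimal solutions of (Ratio) are exactly the $x$-parts of those optimal solutions of the LP relaxation that have binary $z$. -/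

import Mathlib

/-- The data of the problem of maximizing a ratio of two linear combinations of univariate
functions plus a separable function over a polyhedral discrete set.  The points
`p i 0 < ... < p i (d i)` are the possible values of the `i`-th variable; the polyhedron is
`A x ≥ c`. -/
structure RatioProblem (n m : ℕ) where
  d : Fin n → ℕ
  p : (i : Fin n) → Fin (d i + 1) → ℝ
  a₀ : ℝ
  a : Fin n → ℝ
  b₀ : ℝ
  b : Fin n → ℝ
  f : Fin n → ℝ → ℝ
  g : Fin n → ℝ → ℝ
  A : Matrix (Fin m) (Fin n) ℝ
  c : Fin m → ℝ

namespace RatioProblem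

variable {n m : ℕ}

/-- The polyhedron `P = {x | A x ≥ c}`. -/
def polyhedron (I : RatioProblem n m) : Set (Fin n → ℝ) :=
  {x | ∀ r, I.c r ≤ (I.A.mulVec x) r}

/-- The grid `∏ i, {p i 0, ..., p i (d i)}`. -/
def lattice (I : RatioProblem n m) : Set (Fin n → ℝ) :=
  {x | ∀ i, x i ∈ Set.range (I.p i)}

/-- The denominator `b₀ + ∑ i, b i * f i (x i)`. -/
def denom (I : RatioProblem n m) (x : Fin n → ℝ) : ℝ :=
  I.b₀ + ∑ i, I.b i * I.f i (x i)

/-- The objective function of the problem. -/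
noncomputable def objective (I : RatioProblem n m) (x : Fin n → ℝ) : ℝ :=
  (I.a₀ + ∑ i, I.a i * I.f i (x i)) / I.denom x + ∑ i, I.g i (x i)

/-- The feasible region `P ∩ X` of the problem. -/
def feasible (I : RatioProblem n m) : Set (Fin n → ℝ) :=
  I.polyhedron ∩ I.lattice

/-- The variables of the formulation.  In `z i j`, `s i j` and `Z k i j` the index
`j : Fin (d i)` (resp. `Fin (d k)`) stands for the one-based index `j + 1`. -/
structure Vars (I : RatioProblem n m) where
  x : Fin n → ℝ
  z : (i : Fin n) → Fin (I.d i) → ℝ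
  ρ : ℝ
  s : (i : Fin n) → Fin (I.d i) → ℝ
  μ : Fin n → ℝ
  ν : ℝ
  y : Fin n → ℝ
  Z : (k : Fin n) → Fin n → Fin (I.d k) → ℝ

/-- The scaled affine lift `q 0 * ζ + ∑ j = 1..d, (q j - q (j - 1)) * v j` of the values
`q 0, ..., q d`. -/
def lift {d : ℕ} (q : Fin (d + 1) → ℝ) (ζ : ℝ) (v : Fin d → ℝ) : ℝ :=
  q 0 * ζ + ∑ j : Fin d, (q j.succ - q j.castSucc) * v j

/-- The value `f i (p i j)`. -/
def fval (I : RatioProblem n m) (i : Fin n) (j : Fin (I.d i + 1)) : ℝ := I.f i (I.p i j)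

/-- The value `g i (p i j)`. -/
def gval (I : RatioProblem n m) (i : Fin n) (j : Fin (I.d i + 1)) : ℝ := I.g i (I.p i j)

/-- The linear constraints of the formulation, i.e. the feasible region of its linear
programming relaxation. -/
structure LPFeasible (I : RatioProblem n m) (w : I.Vars) : Prop where
  /-- `A x ≥ c` -/
  poly : ∀ r, I.c r ≤ (I.A.mulVec w.x) r
  /-- `x i = p i 0 + ∑ j, (p i j - p i (j-1)) * z i j` -/
  unary : ∀ i, w.x i = lift (I.p i) 1 (w.z i)
  /-- `1 ≥ z i 1 ≥ ... ≥ z i (d i) ≥ 0` -/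
  z_le_one : ∀ i j, w.z i j ≤ 1
  z_antitone : ∀ i, Antitone (w.z i)
  z_nonneg : ∀ i j, 0 ≤ w.z i j
  /-- `b₀ ρ + ∑ i, b i * μ i = 1` -/
  normalization : I.b₀ * w.ρ + ∑ i, I.b i * w.μ i = 1
  /-- `μ i = f i (p i 0) ρ + ∑ j, (f i (p i j) - f i (p i (j-1))) * s i j` -/
  mu_eq : ∀ i, w.μ i = lift (I.fval i) w.ρ (w.s i)
  /-- `ρ ≥ s i 1 ≥ ... ≥ s i (d i) ≥ 0` -/
  s_le_rho : ∀ i j, w.s i j ≤ w.ρ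
  s_antitone : ∀ i, Antitone (w.s i)
  s_nonneg : ∀ i j, 0 ≤ w.s i j
  /-- `A y ≥ c ρ` -/
  scaled_poly : ∀ r, I.c r * w.ρ ≤ (I.A.mulVec w.y) r
  /-- `y i = p i 0 * ρ + ∑ j, (p i j - p i (j-1)) * s i j` -/
  y_eq : ∀ i, w.y i = lift (I.p i) w.ρ (w.s i)
  /-- `ν ≤ ∑ i, (g i (p i 0) + ∑ j, (g i (p i j) - g i (p i (j-1))) * z i j)` -/
  nu_le : w.ν ≤ ∑ i, lift (I.gval i) 1 (w.z i)
  /-- `z k j = b₀ * s k j + ∑ i, b i * Z k i j` -/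
  z_eq : ∀ k j, w.z k j = I.b₀ * w.s k j + ∑ i, I.b i * w.Z k i j
  /-- `Z k i j ≤ f i (p i τ) s k j + ∑ t > τ, (f i (p i t) - f i (p i (t-1))) s i t`
  for all `τ = 0, ..., d i` -/
  Z_le : ∀ k i, i ≠ k → ∀ (j : Fin (I.d k)) (τ : Fin (I.d i + 1)),
    w.Z k i j ≤ I.fval i τ * w.s k j +
      ∑ t : Fin (I.d i) with τ < t.succ, (I.fval i t.succ - I.fval i t.castSucc) * w.s i t
  /-- `Z k i j ≥ f i (p i 0) ρ + ∑ t = 1..τ, (f i (p i t) - f i (p i (t-1))) s i t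
  + f i (p i τ) s k j - f i (p i τ) ρ` for all `τ = 0, ..., d i` -/
  le_Z : ∀ k i, i ≠ k → ∀ (j : Fin (I.d k)) (τ : Fin (I.d i + 1)),
    I.fval i 0 * w.ρ +
      (∑ t : Fin (I.d i) with t.succ ≤ τ, (I.fval i t.succ - I.fval i t.castSucc) * w.s i t) +
      I.fval i τ * w.s k j - I.fval i τ * w.ρ ≤ w.Z k i j
  /-- `Z k k j = f k (p k j) s k j + ∑ t > j, (f k (p k t) - f k (p k (t-1))) s k t` -/
  Z_diag : ∀ k (j : Fin (I.d k)),
    w.Z k k j = I.fval k j.succ * w.s k j +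
      ∑ t : Fin (I.d k) with j < t, (I.fval k t.succ - I.fval k t.castSucc) * w.s k t

/-- The integrality condition `z i j ∈ {0, 1}`. -/
def Binary (I : RatioProblem n m) (w : I.Vars) : Prop :=
  ∀ i j, w.z i j = 0 ∨ w.z i j = 1

/-- Feasible region of the linear programming relaxation. -/
def lpRegion (I : RatioProblem n m) : Set I.Vars := {w | I.LPFeasible w}

/-- Feasible region of the mixed-integer formulation. -/
def mipRegion (I : RatioProblem n m) : Set I.Vars := {w | I.LPFeasible w ∧ I.Binary w}

/-- The linear objective `a₀ ρ + ∑ i, a i * μ i + ν` of the formulation. -/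
def linObjective (I : RatioProblem n m) (w : I.Vars) : ℝ :=
  I.a₀ * w.ρ + ∑ i, I.a i * w.μ i + w.ν

end RatioProblem

/-!
The values `q 0, ..., q d` of a function on a chain of points are encoded by the lift
`q 0 * ζ + ∑ t, (q t - q (t - 1)) * v t`, which equals `q τ * ζ` when `v` is `ζ` on the first `τ`
indices and `0` afterwards (`lift_threshold`). For `i ≠ k` the bounds on `Z k i j` say that it lies
between the lifts of `max 0 (s i t + s k j - ρ)` and of `min (s i t) (s k j)`, both with `ζ = s k j`,
and `Z k k j` is the latter lift (`upper_eq_lift`, `lower_eq_lift`, `upper_diag_eq_lift`).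

*Exactness of the mixed-integer formulation.* Let `D > 0` be the denominator at the lowest grid
point. If `z k j = 0`, the lower bounds on `Z` give `D * s k j ≤ 0`; if `z k j = 1`, subtracting
the equation for `z k j` from the normalization gives `D * (ρ - s k j) ≤ 0`. Hence
`s k j = ρ * z k j` (`LPFeasible.s_eq`), so `μ i = f i (x i) * ρ` and `ρ` is the reciprocal of the
denominator at `x`. Conversely these formulas define a feasible point over each `x`, and
lowering `ν` reaches every value below the objective.

*Exactness of the relaxation.* Let `w` satisfy the linear constraints. Each level `θ ∈ (0, ρ]`
selects a grid point `x(θ)`, by cutting each sequence `s i` at height `θ`. With `Den` the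
denominator, integrals over `(0, ρ]` satisfy `∫ f i (x(θ) i) = μ i` and `∫ Den (x(θ)) = 1`.
Moreover `z k j ≤ ∫ 1[θ ≤ s k j] * Den (x(θ))`, because the integral of a product of two level
indicators is the minimum of the levels. As the increments of `g` are nonnegative, the linear
objective at `w` is at most the integral of `Den (x(θ))` times the objective at `x(θ)`, a weighted
average of objective values (`LPFeasible.linObjective_le`).
-/

namespace RatioProblem

open MeasureTheory

variable {n m d : ℕ}

/-! ### Lifts of sequences of values -/

theorem sum_step_lt (q : Fin (d + 1) → ℝ) (τ : Fin (d + 1)) :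
    ∑ t : Fin d, (q t.succ - q t.castSucc) * (if t.castSucc < τ then 1 else 0) = q τ - q 0 := by
  induction d with
  | zero => simp [Fin.fin_one_eq_zero τ]
  | succ d ih =>
    refine Fin.cases (by simp) (fun σ => ?_) τ
    have h := ih (fun t => q t.succ) σ
    rw [Fin.sum_univ_succ]
    simp only [← Fin.succ_castSucc, Fin.castSucc_zero, Fin.succ_lt_succ_iff, Fin.succ_pos,
      if_true] at h ⊢
    rw [h]
    ring

theorem lift_threshold (q : Fin (d + 1) → ℝ) (ζ : ℝ) (τ : Fin (d + 1)) :
    lift q ζ (fun t => if t.castSucc < τ then ζ else 0) = q τ * ζ := by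
  have h := congrArg (· * ζ) (sum_step_lt q τ)
  simp only [Finset.sum_mul] at h
  rw [lift, ← eq_sub_iff_add_eq', ← sub_mul, ← h]
  refine Finset.sum_congr rfl fun t _ => ?_
  split_ifs <;> ring

theorem lift_mul_right (q : Fin (d + 1) → ℝ) (ζ c : ℝ) (v : Fin d → ℝ) :
    lift q ζ v * c = lift q (ζ * c) (fun t => v t * c) := by
  simp only [lift, add_mul, Finset.sum_mul, mul_assoc]

theorem lift_mono {q : Fin (d + 1) → ℝ} (hq : Monotone q) (ζ : ℝ) {u v : Fin d → ℝ}
    (h : ∀ t, u t ≤ v t) : lift q ζ u ≤ lift q ζ v := by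
  unfold lift
  gcongr with t
  · exact sub_nonneg.2 (hq t.castSucc_lt_succ.le)
  · exact h t

/-- The superlevel sets of a nonincreasing sequence are initial segments. -/
theorem exists_threshold {v : Fin d → ℝ} (hv : Antitone v) (c : ℝ) :
    ∃ τ : Fin (d + 1), ∀ t : Fin d, c ≤ v t ↔ t.castSucc < τ := by
  induction d with
  | zero => exact ⟨0, fun t => t.elim0⟩
  | succ d ih =>
    by_cases h0 : c ≤ v 0
    · obtain ⟨τ, hτ⟩ := ih (v := fun t => v t.succ)
        (fun a b hab => hv (Fin.succ_le_succ_iff.2 hab))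
      refine ⟨τ.succ, fun t => Fin.cases (by simpa using h0) (fun t => ?_) t⟩
      rw [hτ t, ← Fin.succ_castSucc, Fin.succ_lt_succ_iff]
    · exact ⟨0, fun t => by
        simpa using lt_of_le_of_lt (hv (Fin.zero_le t)) (not_le.1 h0)⟩

/-- The upper bounds of the formulation on `Z` as lifts: the terms up to `τ` are truncated
to `c`. -/
theorem upper_eq_lift (q : Fin (d + 1) → ℝ) (c : ℝ) (v : Fin d → ℝ) (τ : Fin (d + 1)) :
    q τ * c + ∑ t : Fin d with τ < t.succ, (q t.succ - q t.castSucc) * v t =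
      lift q c (fun t => if t.castSucc < τ then c else v t) := by
  rw [← lift_threshold q c τ, lift, lift, Finset.sum_filter, add_assoc, ← Finset.sum_add_distrib]
  congr 1
  refine Finset.sum_congr rfl fun t _ => ?_
  by_cases h : t.castSucc < τ
  · have : ¬ τ < t.succ := not_lt.2 (Fin.castSucc_lt_iff_succ_le.1 h)
    simp [h, this]
  · have : τ < t.succ := lt_of_le_of_lt (not_lt.1 h) t.castSucc_lt_succ
    simp [h, this]

/-- The lower bounds of the formulation on `Z` as lifts: the terms up to `τ` are replaced by
`v t + c - ρ`, and the others dropped. -/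
theorem lower_eq_lift (q : Fin (d + 1) → ℝ) (ρ c : ℝ) (v : Fin d → ℝ) (τ : Fin (d + 1)) :
    q 0 * ρ + (∑ t : Fin d with t.succ ≤ τ, (q t.succ - q t.castSucc) * v t) +
        q τ * c - q τ * ρ =
      lift q c (fun t => if t.castSucc < τ then v t + c - ρ else 0) := by
  rw [add_sub_assoc, ← mul_sub, ← lift_threshold q (c - ρ) τ, lift, lift, Finset.sum_filter]
  have : ∀ x y z : ℝ, q 0 * ρ + x + (q 0 * (c - ρ) + y) = q 0 * c + z ↔ x + y = z := by
    intro x y z; constructor <;> intro h <;> linarith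
  rw [this, ← Finset.sum_add_distrib]
  refine Finset.sum_congr rfl fun t _ => ?_
  simp only [← Fin.castSucc_lt_iff_succ_le]
  split_ifs <;> ring

/-- The value prescribed for `Z k k j` is the least of the upper bounds, attained at the index `j`
where the sequence itself has height `v j`. -/
theorem upper_diag_eq_lift (q : Fin (d + 1) → ℝ) {v : Fin d → ℝ} (hv : Antitone v) (j : Fin d) :
    q j.succ * v j + ∑ t : Fin d with j < t, (q t.succ - q t.castSucc) * v t =
      lift q (v j) (fun t => min (v t) (v j)) := by
  have h := upper_eq_lift q (v j) v j.succ
  simp only [Fin.succ_lt_succ_iff, Fin.castSucc_lt_succ_iff] at h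
  rw [h]
  congr 1
  ext t
  split_ifs with ht
  · exact (min_eq_right (hv ht)).symm
  · exact (min_eq_left (hv (not_le.1 ht).le)).symm

theorem monotone_comp_points {I : RatioProblem n m} (hp : ∀ i, StrictMono (I.p i))
    {h : Fin n → ℝ → ℝ} (hh : ∀ i, MonotoneOn (h i) (Set.range (I.p i))) (i : Fin n) :
    Monotone (fun j => h i (I.p i j)) := fun _ _ hab =>
  hh i (Set.mem_range_self _) (Set.mem_range_self _) ((hp i).monotone hab)

/-! ### Consequences of the linear constraints -/

section LP

variable {I : RatioProblem n m} {w : I.Vars}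

theorem LPFeasible.Z_le_lift_min (hw : I.LPFeasible w) (k i : Fin n) (j : Fin (I.d k)) :
    w.Z k i j ≤ lift (I.fval i) (w.s k j) (fun t => min (w.s i t) (w.s k j)) := by
  rcases eq_or_ne i k with rfl | hik
  · rw [hw.Z_diag, upper_diag_eq_lift _ (hw.s_antitone i)]
  · obtain ⟨τ, hτ⟩ := exists_threshold (hw.s_antitone i) (w.s k j)
    refine (hw.Z_le k i hik j τ).trans_eq ?_
    rw [upper_eq_lift]
    congr 1
    ext t
    simp only [← hτ]
    split_ifs with h
    · exact (min_eq_right h).symm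
    · exact (min_eq_left (not_le.1 h).le).symm

theorem LPFeasible.base_mul_le_Z (hw : I.LPFeasible w) (hf : ∀ i, Monotone (I.fval i))
    (k i : Fin n) (j : Fin (I.d k)) : I.fval i 0 * w.s k j ≤ w.Z k i j := by
  rcases eq_or_ne i k with rfl | hik
  · rw [hw.Z_diag, upper_diag_eq_lift _ (hw.s_antitone i)]
    refine le_trans ?_ (lift_mono (hf i) _ (u := fun _ => 0)
      fun t => le_min (hw.s_nonneg i t) (hw.s_nonneg i j))
    simp [lift]
  · refine le_trans ?_ (hw.le_Z k i hik j 0)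
    rw [lower_eq_lift]
    simp [lift]

/-- Replacing the truncated level `s k j` by the full level `ρ` costs at least the
contribution of the lowest value. -/
theorem LPFeasible.base_mul_le_mu_sub_Z (hw : I.LPFeasible w) (hf : ∀ i, Monotone (I.fval i))
    (k i : Fin n) (j : Fin (I.d k)) :
    I.fval i 0 * (w.ρ - w.s k j) ≤ w.μ i - w.Z k i j := by
  have h1 := (hw.Z_le_lift_min k i j).trans
    (lift_mono (hf i) _ (fun t => min_le_left (w.s i t) (w.s k j)))
  rw [hw.mu_eq]
  simp only [lift] at h1 ⊢
  linarith

theorem denom_base_pos (hden : ∀ x ∈ I.lattice, 0 < I.denom x) :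
    0 < I.b₀ + ∑ i, I.b i * I.fval i 0 :=
  hden (fun i => I.p i 0) fun _ => Set.mem_range_self _

/-- In a feasible point with binary `z`, the variable `s k j` is the product `ρ * z k j`. -/
theorem LPFeasible.s_eq (hw : I.LPFeasible w) (hz : I.Binary w) (hb : ∀ i, 0 ≤ I.b i)
    (hf : ∀ i, Monotone (I.fval i)) (hden : ∀ x ∈ I.lattice, 0 < I.denom x)
    (k : Fin n) (j : Fin (I.d k)) : w.s k j = w.ρ * w.z k j := by
  have hD := denom_base_pos hden
  have hze := hw.z_eq k j
  rcases hz k j with h | h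
  · have h1 : ∑ i, I.b i * (I.fval i 0 * w.s k j) ≤ ∑ i, I.b i * w.Z k i j := by
      gcongr with i
      · exact hb i
      · exact hw.base_mul_le_Z hf k i j
    have h2 : (I.b₀ + ∑ i, I.b i * I.fval i 0) * w.s k j ≤ 0 := by
      simp only [← mul_assoc, ← Finset.sum_mul] at h1
      linarith
    rw [h, mul_zero]
    exact le_antisymm (nonpos_of_mul_nonpos_right h2 hD) (hw.s_nonneg k j)
  · have h1 : ∑ i, I.b i * (I.fval i 0 * (w.ρ - w.s k j)) ≤
        ∑ i, I.b i * (w.μ i - w.Z k i j) := by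
      gcongr with i
      · exact hb i
      · exact hw.base_mul_le_mu_sub_Z hf k i j
    have hn := hw.normalization
    have h2 : (I.b₀ + ∑ i, I.b i * I.fval i 0) * (w.ρ - w.s k j) ≤ 0 := by
      simp only [← mul_assoc, ← Finset.sum_mul, mul_sub _ (w.μ _), Finset.sum_sub_distrib] at h1
      linarith
    rw [h, mul_one]
    exact le_antisymm (hw.s_le_rho k j) (sub_nonpos.1 (nonpos_of_mul_nonpos_right h2 hD))

theorem LPFeasible.rho_nonneg (hw : I.LPFeasible w)
    (hden : ∀ x ∈ I.lattice, 0 < I.denom x) : 0 ≤ w.ρ := by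
  by_cases h : ∃ i, Nonempty (Fin (I.d i))
  · obtain ⟨i, ⟨j⟩⟩ := h
    exact (hw.s_nonneg i j).trans (hw.s_le_rho i j)
  · have hn := hw.normalization
    have hμ : ∀ i, w.μ i = I.fval i 0 * w.ρ := fun i => by
      have : IsEmpty (Fin (I.d i)) := not_nonempty_iff.1 fun hi => h ⟨i, hi⟩
      simp [hw.mu_eq, lift]
    simp only [hμ, ← mul_assoc, ← Finset.sum_mul, ← add_mul] at hn
    exact (pos_of_mul_pos_right (hn ▸ one_pos) (denom_base_pos hden).le).le

end LP

/-! ### The mixed-integer formulation -/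

theorem mem_feasible_of_mem_mipRegion {I : RatioProblem n m} {w : I.Vars}
    (hb : ∀ i, 0 ≤ I.b i) (hf : ∀ i, Monotone (I.fval i))
    (hden : ∀ x ∈ I.lattice, 0 < I.denom x) (h : w ∈ I.mipRegion) :
    w.x ∈ I.feasible ∧ I.linObjective w ≤ I.objective w.x := by
  obtain ⟨hw, hz⟩ := h
  choose τ hτ using fun i => exists_threshold (hw.z_antitone i) 1
  have hzt : ∀ i, w.z i = fun t => if t.castSucc < τ i then 1 else 0 := fun i => by
    ext t
    rw [← if_congr (hτ i t) rfl rfl]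
    rcases hz i t with h | h <;> simp [h]
  have hst : ∀ i, w.s i = fun t => if t.castSucc < τ i then w.ρ else 0 := fun i => by
    ext t
    rw [hw.s_eq hz hb hf hden, hzt]
    simp
  have hx : w.x = fun i => I.p i (τ i) := by
    ext i
    rw [hw.unary, hzt, lift_threshold, mul_one]
  have hμ : ∀ i, w.μ i = I.f i (w.x i) * w.ρ := fun i => by
    rw [hw.mu_eq, hst, lift_threshold, hx, fval]
  have hg : ∀ i, lift (I.gval i) 1 (w.z i) = I.g i (w.x i) := fun i => by
    rw [hzt, lift_threshold, mul_one, hx, gval]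
  have hl : w.x ∈ I.lattice := fun i => by simp [hx]
  have hn : I.denom w.x * w.ρ = 1 := by
    rw [← hw.normalization, denom, add_mul, Finset.sum_mul]
    simp only [hμ, mul_assoc]
  refine ⟨⟨hw.poly, hl⟩, ?_⟩
  have hν := hw.nu_le
  simp only [hg] at hν
  have hρ : w.ρ = (I.denom w.x)⁻¹ := eq_inv_of_mul_eq_one_right hn
  simp only [linObjective, objective, hμ, div_eq_mul_inv, ← hρ, add_mul, Finset.sum_mul, mul_assoc]
  linarith

theorem exists_mem_mipRegion {I : RatioProblem n m} (hf : ∀ i, Monotone (I.fval i))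
    (hden : ∀ x ∈ I.lattice, 0 < I.denom x) {x : Fin n → ℝ} {t : ℝ} (hx : x ∈ I.feasible)
    (ht : t ≤ I.objective x) : ∃ w ∈ I.mipRegion, w.x = x ∧ I.linObjective w = t := by
  have hD := hden x hx.2
  choose τ hτ using hx.2
  set ρ := (I.denom x)⁻¹ with hρ
  have hρ0 : 0 ≤ ρ := (inv_pos.2 hD).le
  let z : (i : Fin n) → Fin (I.d i) → ℝ := fun i j => if j.castSucc < τ i then 1 else 0
  let s : (i : Fin n) → Fin (I.d i) → ℝ := fun i j => if j.castSucc < τ i then ρ else 0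
  have hfx : ∀ i, I.fval i (τ i) = I.f i (x i) := fun i => by rw [fval, hτ]
  have hza : ∀ i, Antitone (z i) := fun i a b hab => by
    simp only [z]
    split_ifs with h1 h2 <;> first | exact le_rfl | exact zero_le_one | skip
    exact absurd (lt_of_le_of_lt (Fin.castSucc_le_castSucc_iff.2 hab) h1) h2
  have hsz : ∀ i j, s i j = ρ * z i j := fun i j => by simp [s, z]
  have hsa : ∀ i, Antitone (s i) := fun i a b hab => by
    rw [hsz, hsz]; exact mul_le_mul_of_nonneg_left (hza i hab) hρ0
  have hz01 : ∀ i j, z i j = 0 ∨ z i j = 1 := fun i j => by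
    simp only [z]; split_ifs <;> simp
  have hs01 : ∀ i j, s i j = 0 ∨ s i j = ρ := fun i j => by
    simp only [s]; split_ifs <;> simp
  have hs0 : ∀ i j, 0 ≤ s i j := fun i j => by
    rcases hs01 i j with h | h <;> rw [h]; exact hρ0
  have hs1 : ∀ i j, s i j ≤ ρ := fun i j => by
    rcases hs01 i j with h | h <;> rw [h]; exact hρ0
  -- as `s` takes only the values `0` and `ρ`, both bounds on `Z` are tight
  have hmul : ∀ k j i, I.f i (x i) * s k j =
      lift (I.fval i) (s k j) (fun t => min (s i t) (s k j)) := fun k j i => by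
    rw [← hfx, ← lift_threshold]
    congr 1
    ext t
    rcases hs01 k j with h | h <;> by_cases h' : t.castSucc < τ i <;> simp [h, h', s, hρ0]
  have hmul' : ∀ k j i, I.f i (x i) * s k j =
      lift (I.fval i) (s k j) (fun t => max 0 (s i t + s k j - ρ)) := fun k j i => by
    rw [← hfx, ← lift_threshold]
    congr 1
    ext t
    rcases hs01 k j with h | h <;> by_cases h' : t.castSucc < τ i <;> simp [h, h', s, hρ0]
  have hn : I.b₀ * ρ + ∑ i, I.b i * (I.f i (x i) * ρ) = 1 := by
    rw [← mul_inv_cancel₀ hD.ne', ← hρ, denom, add_mul, Finset.sum_mul]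
    simp only [mul_assoc]
  refine ⟨⟨x, z, ρ, s, fun i => I.f i (x i) * ρ,
    t - I.a₀ * ρ - ∑ i, I.a i * (I.f i (x i) * ρ), fun i => x i * ρ,
    fun k i j => I.f i (x i) * s k j⟩, ⟨?_, hz01⟩, rfl, ?_⟩
  · constructor <;> dsimp only
    · exact hx.1
    · exact fun i => by rw [← hτ, lift_threshold, mul_one]
    · exact fun i j => by rcases hz01 i j with h | h <;> simp [h]
    · exact hza
    · exact fun i j => by rcases hz01 i j with h | h <;> simp [h]
    · exact hn
    · exact fun i => by rw [lift_threshold, hfx]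
    · exact hs1
    · exact hsa
    · exact hs0
    · intro r
      refine (mul_le_mul_of_nonneg_right (hx.1 r) hρ0).trans_eq ?_
      simp only [Matrix.mulVec, dotProduct, Finset.sum_mul, mul_assoc]
    · exact fun i => by rw [lift_threshold, hτ]
    · have hg : ∀ i, lift (I.gval i) 1 (z i) = I.g i (x i) := fun i => by
        rw [lift_threshold, mul_one, gval, hτ]
      simp only [objective, div_eq_mul_inv, ← hρ, add_mul, Finset.sum_mul, mul_assoc] at ht
      simp only [hg]
      linarith
    · intro k j
      have h := congrArg (· * z k j) hn
      simp only [add_mul, Finset.sum_mul, one_mul, mul_assoc, ← hsz] at h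
      exact h.symm
    · intro k i _ j τ'
      rw [upper_eq_lift, hmul]
      refine lift_mono (hf i) _ fun t => ?_
      split_ifs
      exacts [min_le_right _ _, min_le_left _ _]
    · intro k i _ j τ'
      rw [lower_eq_lift, hmul']
      refine lift_mono (hf i) _ fun t => ?_
      split_ifs
      exacts [le_max_right _ _, le_max_left _ _]
    · intro k j
      rw [upper_diag_eq_lift _ (hsa k), hmul]
  · simp only [linObjective]
    ring

/-! ### The linear programming relaxation -/

/-- The indicator of `(-∞, c]`. -/
noncomputable def level (c θ : ℝ) : ℝ := if θ ≤ c then 1 else 0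

theorem level_mul_level (c c' θ : ℝ) : level c θ * level c' θ = level (min c c') θ := by
  by_cases h : θ ≤ c <;> by_cases h' : θ ≤ c' <;> simp [level, h, h']

theorem intervalIntegrable_level (c a b : ℝ) : IntervalIntegrable (level c) volume a b := by
  refine Antitone.intervalIntegrable fun u v huv => ?_
  unfold level
  split_ifs with h1 h2 <;> first | exact le_rfl | exact zero_le_one | skip
  exact absurd (huv.trans h1) h2

theorem integral_level {c ρ : ℝ} (hc : 0 ≤ c) (hcρ : c ≤ ρ) :
    ∫ θ in (0 : ℝ)..ρ, level c θ = c := by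
  rw [← intervalIntegral.integral_add_adjacent_intervals
    (intervalIntegrable_level c 0 c) (intervalIntegrable_level c c ρ)]
  have h1 : ∫ θ in (0 : ℝ)..c, level c θ = ∫ θ in (0 : ℝ)..c, (1 : ℝ) := by
    refine intervalIntegral.integral_congr_ae (Filter.Eventually.of_forall fun θ hθ => ?_)
    rw [Set.uIoc_of_le hc] at hθ
    simp [level, hθ.2]
  have h2 : ∫ θ in c..ρ, level c θ = ∫ θ in c..ρ, (0 : ℝ) := by
    refine intervalIntegral.integral_congr_ae (Filter.Eventually.of_forall fun θ hθ => ?_)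
    rw [Set.uIoc_of_le hcρ] at hθ
    simp [level, hθ.1]
  rw [h1, h2]
  simp

theorem intervalIntegrable_lift (q : Fin (d + 1) → ℝ) {h : ℝ → ℝ} {u : Fin d → ℝ → ℝ} {a b : ℝ}
    (hh : IntervalIntegrable h volume a b) (hu : ∀ t, IntervalIntegrable (u t) volume a b) :
    IntervalIntegrable (fun θ => lift q (h θ) (fun t => u t θ)) volume a b := by
  refine (hh.const_mul _).add ?_
  simpa only [Finset.sum_fn] using IntervalIntegrable.sum Finset.univ
    fun t _ => (hu t).const_mul (q t.succ - q t.castSucc)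

theorem integral_lift (q : Fin (d + 1) → ℝ) {h : ℝ → ℝ} {u : Fin d → ℝ → ℝ} {a b : ℝ}
    (hh : IntervalIntegrable h volume a b) (hu : ∀ t, IntervalIntegrable (u t) volume a b) :
    ∫ θ in a..b, lift q (h θ) (fun t => u t θ) =
      lift q (∫ θ in a..b, h θ) (fun t => ∫ θ in a..b, u t θ) := by
  have hs : ∀ t ∈ Finset.univ, IntervalIntegrable
      (fun θ => (q t.succ - q t.castSucc) * u t θ) volume a b :=
    fun t _ => (hu t).const_mul _
  simp only [lift]
  rw [intervalIntegral.integral_add (hh.const_mul _)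
    (by simpa only [Finset.sum_fn] using IntervalIntegrable.sum Finset.univ hs),
    intervalIntegral.integral_finsetSum hs]
  simp only [intervalIntegral.integral_const_mul]

theorem intervalIntegrable_add_sum (c₀ : ℝ) (c : Fin n → ℝ) {h : ℝ → ℝ} {u : Fin n → ℝ → ℝ}
    {a b : ℝ} (hh : IntervalIntegrable h volume a b)
    (hu : ∀ i, IntervalIntegrable (u i) volume a b) :
    IntervalIntegrable (fun θ => c₀ * h θ + ∑ i, c i * u i θ) volume a b := by
  refine (hh.const_mul _).add ?_
  simpa only [Finset.sum_fn] using IntervalIntegrable.sum Finset.univ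
    fun i _ => (hu i).const_mul (c i)

theorem integral_add_sum (c₀ : ℝ) (c : Fin n → ℝ) {h : ℝ → ℝ} {u : Fin n → ℝ → ℝ}
    {a b : ℝ} (hh : IntervalIntegrable h volume a b)
    (hu : ∀ i, IntervalIntegrable (u i) volume a b) :
    ∫ θ in a..b, (c₀ * h θ + ∑ i, c i * u i θ) =
      c₀ * (∫ θ in a..b, h θ) + ∑ i, c i * ∫ θ in a..b, u i θ := by
  have hs : ∀ i ∈ Finset.univ, IntervalIntegrable (fun θ => c i * u i θ) volume a b :=
    fun i _ => (hu i).const_mul _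
  rw [intervalIntegral.integral_add (hh.const_mul _)
    (by simpa only [Finset.sum_fn] using IntervalIntegrable.sum Finset.univ hs),
    intervalIntegral.integral_finsetSum hs]
  simp only [intervalIntegral.integral_const_mul]

/-- A bound on the objective over the grid is a bound on the relaxation.  Each level
`θ ∈ (0, ρ]` selects the grid point whose `i`-th coordinate has index `#{t | θ ≤ s i t}`, and the
objective of the relaxation is at most the integral over `θ` of denominator times objective at the
selected points, while the denominators integrate to `1`. -/
theorem LPFeasible.linObjective_le {I : RatioProblem n m} {w : I.Vars} (hw : I.LPFeasible w)
    (hb : ∀ i, 0 ≤ I.b i) (hg : ∀ i, Monotone (I.gval i))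
    (hden : ∀ x ∈ I.lattice, 0 < I.denom x) {v : ℝ} (hv : ∀ x ∈ I.lattice, I.objective x ≤ v) :
    I.linObjective w ≤ v := by
  have hρ := hw.rho_nonneg hden
  -- `F i θ` and `D θ` are `f i` and the denominator at the grid point selected by `θ`
  let F : Fin n → ℝ → ℝ := fun i θ => lift (I.fval i) 1 (fun t => level (w.s i t) θ)
  let D : ℝ → ℝ := fun θ => I.b₀ * 1 + ∑ i, I.b i * F i θ
  have h1 : IntervalIntegrable (fun _ : ℝ => (1 : ℝ)) volume 0 w.ρ := intervalIntegrable_const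
  have hF : ∀ i, IntervalIntegrable (F i) volume 0 w.ρ := fun i =>
    intervalIntegrable_lift _ h1 fun t => intervalIntegrable_level _ _ _
  have hD : IntervalIntegrable D volume 0 w.ρ := intervalIntegrable_add_sum _ _ h1 hF
  have hFint : ∀ i, ∫ θ in (0 : ℝ)..w.ρ, F i θ = w.μ i := fun i => by
    rw [integral_lift _ h1 fun t => intervalIntegrable_level _ _ _, hw.mu_eq]
    simp [integral_level (hw.s_nonneg i _) (hw.s_le_rho i _)]
  have hDint : ∫ θ in (0 : ℝ)..w.ρ, D θ = 1 := by
    rw [integral_add_sum _ _ h1 hF, intervalIntegral.integral_const, smul_eq_mul, mul_one,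
      sub_zero, ← hw.normalization]
    simp only [hFint]
  have hFl : ∀ i k j θ, F i θ * level (w.s k j) θ = lift (I.fval i) (level (w.s k j) θ)
      (fun t => level (min (w.s i t) (w.s k j)) θ) := fun i k j θ => by
    simp only [F, lift_mul_right, one_mul, level_mul_level]
  have hDl : ∀ k j, (fun θ => level (w.s k j) θ * D θ) = fun θ =>
      I.b₀ * level (w.s k j) θ + ∑ i, I.b i * lift (I.fval i) (level (w.s k j) θ)
      (fun t => level (min (w.s i t) (w.s k j)) θ) := fun k j => by
    ext θ
    simp only [← hFl, D, mul_comm (level _ _), add_mul, Finset.sum_mul, mul_assoc, one_mul]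
  have hFli : ∀ k j i, IntervalIntegrable (fun θ => lift (I.fval i) (level (w.s k j) θ)
      (fun t => level (min (w.s i t) (w.s k j)) θ)) volume 0 w.ρ := fun k j i =>
    intervalIntegrable_lift _ (intervalIntegrable_level _ _ _)
      fun t => intervalIntegrable_level _ _ _
  have hDli : ∀ k j, IntervalIntegrable (fun θ => level (w.s k j) θ * D θ) volume 0 w.ρ :=
    fun k j => by
      rw [hDl]
      exact intervalIntegrable_add_sum _ _ (intervalIntegrable_level _ _ _) (hFli k j)
  have hz : ∀ k j, w.z k j ≤ ∫ θ in (0 : ℝ)..w.ρ, level (w.s k j) θ * D θ := fun k j => by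
    rw [hDl, integral_add_sum _ _ (intervalIntegrable_level _ _ _) (hFli k j), hw.z_eq,
      integral_level (hw.s_nonneg k j) (hw.s_le_rho k j)]
    gcongr with i
    · exact hb i
    · refine (hw.Z_le_lift_min k i j).trans_eq ?_
      rw [integral_lift _ (intervalIntegrable_level _ _ _)
        fun t => intervalIntegrable_level _ _ _,
        integral_level (hw.s_nonneg k j) (hw.s_le_rho k j)]
      congr 1
      ext t
      exact (integral_level (le_min (hw.s_nonneg i t) (hw.s_nonneg k j))
        ((min_le_right _ _).trans (hw.s_le_rho k j))).symm
  let G : Fin n → ℝ → ℝ := fun k θ =>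
    lift (I.gval k) (D θ) (fun t => level (w.s k t) θ * D θ)
  have hG : ∀ k, IntervalIntegrable (G k) volume 0 w.ρ := fun k =>
    intervalIntegrable_lift _ hD (hDli k)
  have hGint : ∀ k, lift (I.gval k) 1 (w.z k) ≤ ∫ θ in (0 : ℝ)..w.ρ, G k θ := fun k => by
    rw [integral_lift _ hD (hDli k), hDint]
    exact lift_mono (hg k) _ (hz k)
  have hN : IntervalIntegrable (fun θ => I.a₀ * 1 + ∑ i, I.a i * F i θ) volume 0 w.ρ :=
    intervalIntegrable_add_sum _ _ h1 hF
  have hS : IntervalIntegrable (fun θ => 0 * 1 + ∑ i, 1 * G i θ) volume 0 w.ρ :=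
    intervalIntegrable_add_sum _ _ h1 hG
  have hpt : ∀ θ, (I.a₀ * 1 + ∑ i, I.a i * F i θ) + (0 * 1 + ∑ i, 1 * G i θ) ≤ v * D θ := by
    intro θ
    choose τ hτ using fun i => exists_threshold (hw.s_antitone i) θ
    have hl : (fun i => I.p i (τ i)) ∈ I.lattice := fun i => Set.mem_range_self _
    have hlev : ∀ i, (fun t => level (w.s i t) θ) = fun t => if t.castSucc < τ i then 1 else 0 :=
      fun i => by
        ext t
        simp only [level, hτ]
    have hFθ : ∀ i, F i θ = I.fval i (τ i) := fun i => by
      simp only [F]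
      rw [hlev, lift_threshold, mul_one]
    have hDθ : D θ = I.denom (fun i => I.p i (τ i)) := by
      simp only [D, hFθ, mul_one]
      rfl
    have hGθ : ∀ i, G i θ = I.gval i (τ i) * D θ := fun i => by
      have h := lift_mul_right (I.gval i) 1 (D θ) (fun t => level (w.s i t) θ)
      rw [one_mul] at h
      simp only [G]
      rw [← h, hlev, lift_threshold, mul_one]
    have hDpos := hden _ hl
    have h := mul_le_mul_of_nonneg_right (hv _ hl) hDpos.le
    rw [objective, add_mul, div_mul_cancel₀ _ hDpos.ne', Finset.sum_mul, ← hDθ] at h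
    simp only [hFθ, hGθ, zero_add, one_mul, mul_one]
    exact h
  have hint := intervalIntegral.integral_mono_on hρ (hN.add hS) (hD.const_mul v)
    fun θ _ => hpt θ
  rw [intervalIntegral.integral_const_mul, hDint,
    intervalIntegral.integral_add hN hS, integral_add_sum _ _ h1 hF, integral_add_sum _ _ h1 hG]
    at hint
  simp only [hFint, intervalIntegral.integral_const, smul_eq_mul, sub_zero, mul_one, zero_mul,
    zero_add, one_mul] at hint
  have hsum := Finset.sum_le_sum fun k (_ : k ∈ Finset.univ) => hGint k
  have hν := hw.nu_le
  rw [linObjective]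
  linarith

theorem finite_lattice (I : RatioProblem n m) : I.lattice.Finite :=
  Set.Finite.pi' fun i => Set.finite_range (I.p i)

theorem lattice_nonempty (I : RatioProblem n m) : I.lattice.Nonempty :=
  ⟨fun i => I.p i 0, fun _ => Set.mem_range_self _⟩

end RatioProblem

/-! ### Optimal values and solutions -/

theorem theorem3 {n m : ℕ} (I : RatioProblem n m)
    (hp : ∀ i, StrictMono (I.p i))
    (hb₀ : 0 ≤ I.b₀) (hb : ∀ i, 0 ≤ I.b i)
    (hf : ∀ i, MonotoneOn (I.f i) (Set.range (I.p i)))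
    (hden : ∀ x ∈ I.lattice, 0 < I.denom x) :
    -- the system is a mixed-integer formulation of the problem: its projection on `x` and the
    -- objective value is the hypograph of the objective over the feasible region ...
    ((fun w : I.Vars => (w.x, I.linObjective w)) '' I.mipRegion =
        {q : (Fin n → ℝ) × ℝ | q.1 ∈ I.feasible ∧ q.2 ≤ I.objective q.1}) ∧
    (∀ v : ℝ, IsGreatest (I.linObjective '' I.mipRegion) v ↔
        IsGreatest (I.objective '' I.feasible) v) ∧
    (∀ x : Fin n → ℝ, (x ∈ I.feasible ∧ IsMaxOn I.objective I.feasible x) ↔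
        ∃ w ∈ I.mipRegion, w.x = x ∧ IsMaxOn I.linObjective I.mipRegion w) ∧
    -- the linear programming relaxation solves the problem
    (I.polyhedron = Set.univ → (∀ i, MonotoneOn (I.g i) (Set.range (I.p i))) →
      (∃ v : ℝ, IsGreatest (I.objective '' I.feasible) v ∧
        IsGreatest (I.linObjective '' I.lpRegion) v) ∧
      (∀ x : Fin n → ℝ, (x ∈ I.feasible ∧ IsMaxOn I.objective I.feasible x) ↔
        ∃ w ∈ I.lpRegion, I.Binary w ∧ w.x = x ∧ IsMaxOn I.linObjective I.lpRegion w)) := by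
  have hF : ∀ i, Monotone (I.fval i) := RatioProblem.monotone_comp_points hp hf
  have hfwd := fun w => RatioProblem.mem_feasible_of_mem_mipRegion (w := w) hb hF hden
  have hbwd := fun x hx => RatioProblem.exists_mem_mipRegion (x := x) hF hden hx le_rfl
  have hopt : ∀ x : Fin n → ℝ, (x ∈ I.feasible ∧ IsMaxOn I.objective I.feasible x) ↔
      ∃ w ∈ I.mipRegion, w.x = x ∧ IsMaxOn I.linObjective I.mipRegion w := by
    intro x
    constructor
    · rintro ⟨hx, hmax⟩
      obtain ⟨w, hw, hwx, hwo⟩ := hbwd x hx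
      refine ⟨w, hw, hwx, fun u hu => ?_⟩
      exact ((hfwd u hu).2.trans (hmax (hfwd u hu).1)).trans_eq hwo.symm
    · rintro ⟨w, hw, rfl, hmax⟩
      refine ⟨(hfwd w hw).1, fun x' hx' => ?_⟩
      obtain ⟨u, hu, -, huo⟩ := hbwd x' hx'
      exact huo.symm.le.trans ((hmax hu).trans (hfwd w hw).2)
  refine ⟨?_, ?_, hopt, ?_⟩
  · ext ⟨x, t⟩
    constructor
    · rintro ⟨w, hw, h⟩
      obtain ⟨rfl, rfl⟩ := Prod.mk.inj h
      exact hfwd w hw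
    · rintro ⟨hx, ht⟩
      obtain ⟨w, hw, hwx, hwo⟩ := RatioProblem.exists_mem_mipRegion hF hden hx ht
      exact ⟨w, hw, Prod.ext hwx hwo⟩
  · intro v
    constructor
    · rintro ⟨⟨w, hw, rfl⟩, hmax⟩
      obtain ⟨hx, hle⟩ := hfwd w hw
      obtain ⟨u, hu, -, huo⟩ := hbwd _ hx
      refine ⟨⟨w.x, hx, le_antisymm (huo ▸ hmax ⟨u, hu, rfl⟩) hle⟩, ?_⟩
      rintro _ ⟨x, hx, rfl⟩
      obtain ⟨u, hu, -, huo⟩ := hbwd x hx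
      exact huo ▸ hmax ⟨u, hu, rfl⟩
    · rintro ⟨⟨x, hx, rfl⟩, hmax⟩
      obtain ⟨w, hw, -, hwo⟩ := hbwd x hx
      refine ⟨⟨w, hw, hwo⟩, ?_⟩
      rintro _ ⟨u, hu, rfl⟩
      exact (hfwd u hu).2.trans (hmax ⟨u.x, (hfwd u hu).1, rfl⟩)
  · intro hP hg
    have hfeas : I.feasible = I.lattice := by rw [RatioProblem.feasible, hP, Set.univ_inter]
    have hG : ∀ i, Monotone (I.gval i) := RatioProblem.monotone_comp_points hp hg
    have hlp : ∀ v, (∀ x ∈ I.feasible, I.objective x ≤ v) →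
        ∀ w ∈ I.lpRegion, I.linObjective w ≤ v := fun v hv w hw =>
      RatioProblem.LPFeasible.linObjective_le hw hb hG hden (hfeas ▸ hv)
    constructor
    · obtain ⟨x, hx, hmax⟩ := I.finite_lattice.exists_maximalFor I.objective _ I.lattice_nonempty
      have hle : ∀ y ∈ I.feasible, I.objective y ≤ I.objective x := fun y hy =>
        (le_total _ _).elim id fun h => hmax (hfeas ▸ hy) h
      rw [← hfeas] at hx
      obtain ⟨w, hw, -, hwo⟩ := hbwd x hx
      refine ⟨I.objective x, ⟨⟨x, hx, rfl⟩, ?_⟩, ⟨w, hw.1, hwo⟩, ?_⟩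
      · rintro _ ⟨y, hy, rfl⟩
        exact hle y hy
      · rintro _ ⟨u, hu, rfl⟩
        exact hlp _ hle u hu
    · intro x
      constructor
      · rintro ⟨hx, hmax⟩
        obtain ⟨w, hw, hwx, hwo⟩ := hbwd x hx
        exact ⟨w, hw.1, hw.2, hwx, fun u hu =>
          (hlp _ (fun y hy => hmax hy) u hu).trans_eq hwo.symm⟩
      · rintro ⟨w, hw, hz, hwx, hmax⟩
        exact (hopt x).2 ⟨w, ⟨hw, hz⟩, hwx, fun u hu => hmax hu.1⟩
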